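/- Let $\mathbb D=\{z\in\mathbb C:|z|<1\}$ with hyperbolic area measure $d\mathrm{vol}_H(z)=(1-|z|^2)^{-2}\,dx\,dy$. Let $M_D$ be the group of disk-preserving Möbius transformations $m(z)=e^{i\theta}\frac{z-a}{1-\bar a z}$ ($a\in\mathbb D$, $\theta\in\mathbb R$). Fix $R>0$ and, for $z_0\in\mathbb D$, let $$\Omega_{z_0,R}=\Big\{z\in\mathbb D:\Big|\tfrac{z-z_0}{1-\bar z_0 z}\Big|\le\tanh R\Big\}$$ be the hyperbolic geodesic disk of radius $R$ centered at $z_0$ (for the metric $(1-|z|^2)^{-2}(dx^2+dy^2)$). Let $\mu,\nu:\mathbb D\to(0,\infty)$ be continuous with $\int_{\mathbb D}\mu\,d\mathrm{vol}_H=\int_{\mathbb D}\nu\,d\mathrm{vol}_H=1$; denote the probability measures $\mu\,d\mathrm{vol}_H$ and $\nu\,d\mathrm{vol}_H$ also by $\mu$ and $\nu$, and let $\Pi(\mu,\nu)$ be the set of Borel probability measures on $\mathbb D\times\mathbb D$ with marginals $\mu$ and $\nu$. Define $$d^R_{\mu,\nu}(z_0,w_0)=\inf_{m\in M_D,\ m(z_0)=w_0}\int_{\Omega_{z_0,R}}|\mu(z)-\nu(m(z))|\,d\mathrm{vol}_H(z).$$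 Theorem. The function $d^R_{\mu,\nu}$ is integrable with respect to every $\pi\in\Pi(\mu,\nu)$, and there exists $\pi^*\in\Pi(\mu,\nu)$ such that $$\int_{\mathbb D\times\mathbb D}d^R_{\mu,\nu}(z,w)\,d\pi^*(z,w)=\inf_{\pi\in\Pi(\mu,\nu)}\int_{\mathbb D\times\mathbb D}d^R_{\mu,\nu}(z,w)\,d\pi(z,w).$$ -/

import Mathlib

open MeasureTheory
open scoped ComplexConjugate Complex.UnitDisc

noncomputable section

namespace ConformalWasserstein

/-- The open unit disk carries its Borel σ-algebra. -/
instance instMeasurableSpaceUnitDisc : MeasurableSpace 𝔻 := borel 𝔻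

instance instBorelSpaceUnitDisc : BorelSpace 𝔻 := ⟨rfl⟩

/-- The denominator of a disk-preserving Möbius transformation does not vanish on the disk. -/
theorem one_sub_conj_mul_ne_zero (a z : 𝔻) : (1 : ℂ) - conj (a : ℂ) * (z : ℂ) ≠ 0 := by
  intro h
  have h1 : conj (a : ℂ) * (z : ℂ) = 1 := (sub_eq_zero.mp h).symm
  have h2 : ‖(a : ℂ)‖ * ‖(z : ℂ)‖ = 1 := by
    have := congrArg norm h1
    simpa using this
  have ha := a.norm_lt_one
  have hz := z.norm_lt_one
  nlinarith [norm_nonneg (a : ℂ), norm_nonneg (z : ℂ)]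

/-- For points `a`, `z` of the disk, `(z - a) / (1 - conj a * z)` lies in the disk. -/
theorem norm_mobius_lt_one (a z : 𝔻) :
    ‖((z : ℂ) - a) / (1 - conj (a : ℂ) * z)‖ < 1 := by
  have hne := one_sub_conj_mul_ne_zero a z
  have hpos : 0 < ‖(1 : ℂ) - conj (a : ℂ) * (z : ℂ)‖ := norm_pos_iff.mpr hne
  rw [norm_div, div_lt_one hpos]
  refine lt_of_pow_lt_pow_left₀ 2 hpos.le ?_
  have ha := a.normSq_lt_one
  have hz := z.normSq_lt_one
  rw [← Complex.normSq_eq_norm_sq, ← Complex.normSq_eq_norm_sq]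
  simp only [Complex.normSq_apply, Complex.sub_re, Complex.sub_im, Complex.mul_re,
    Complex.mul_im, Complex.conj_re, Complex.conj_im, Complex.one_re, Complex.one_im] at *
  nlinarith [mul_pos (sub_pos.mpr ha) (sub_pos.mpr hz)]

/-- The disk-preserving Möbius transformation `z ↦ τ (z - a) / (1 - conj a * z)`,
with `|τ| = 1` and `|a| < 1`. -/
def mobius (τ : Circle) (a z : 𝔻) : 𝔻 :=
  τ • Complex.UnitDisc.mk (((z : ℂ) - a) / (1 - conj (a : ℂ) * z)) (norm_mobius_lt_one a z)

/-- The set of all disk-preserving Möbius transformations, as self-maps of the disk. -/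
def diskMobius : Set (𝔻 → 𝔻) :=
  {m | ∃ (τ : Circle) (a : 𝔻), m = mobius τ a}

/-- The hyperbolic area measure `(1 - |z|²)⁻² dx dy` on the disk. -/
def hypVolume : Measure 𝔻 :=
  ((volume : Measure ℂ).comap ((↑) : 𝔻 → ℂ)).withDensity
    fun z => ENNReal.ofReal (((1 - ‖(z : ℂ)‖ ^ 2) ^ 2)⁻¹)

/-- The (closed) hyperbolic geodesic disk of radius `R` centered at `z₀`, for the metric
`(1 - |z|²)⁻² (dx² + dy²)`: the preimage of `{z : |z| ≤ tanh R}` under the Möbius transformation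
`z ↦ (z - z₀) / (1 - conj z₀ * z)`. -/
def hypDisk (R : ℝ) (z₀ : 𝔻) : Set 𝔻 :=
  {z | ‖(mobius 1 z₀ z : ℂ)‖ ≤ Real.tanh R}

/-- `μ` is the hyperbolic density function of a disk-type surface of total area `1`: it is
continuous and positive, and has integral `1` with respect to the hyperbolic area. -/
structure IsHyperbolicDensity (μ : 𝔻 → ℝ) : Prop where
  continuous : Continuous μ
  pos : ∀ z, 0 < μ z
  lintegral_eq_one : ∫⁻ z, ENNReal.ofReal (μ z) ∂hypVolume = 1

/-- The measure `μ d vol_H` on the disk with hyperbolic density function `μ`. -/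
def densityMeasure (μ : 𝔻 → ℝ) : Measure 𝔻 :=
  hypVolume.withDensity fun z => ENNReal.ofReal (μ z)

/-- `∫_{Ω_{z₀,R}} |μ - m^* ν| d vol_H`, where the pull-back is `m^* ν = ν ∘ m`. -/
def patchMismatch (R : ℝ) (μ ν : 𝔻 → ℝ) (z₀ : 𝔻) (m : 𝔻 → 𝔻) : ℝ :=
  ∫ z in hypDisk R z₀, |μ z - ν (m z)| ∂hypVolume

/-- The cost function `d^R_{μ,ν}(z₀, w₀)`: the infimum of `∫_{Ω_{z₀,R}} |μ - m^* ν| d vol_H` over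
the disk-preserving Möbius transformations `m` with `m z₀ = w₀`. -/
def cost (R : ℝ) (μ ν : 𝔻 → ℝ) (z₀ w₀ : 𝔻) : ℝ :=
  ⨅ m : {m : 𝔻 → 𝔻 // m ∈ diskMobius ∧ m z₀ = w₀}, patchMismatch R μ ν z₀ m

/-- `Π(P, Q)`: the probability measures on the product with marginals `P` and `Q`. -/
def couplings {X Y : Type*} [MeasurableSpace X] [MeasurableSpace Y]
    (P : Measure X) (Q : Measure Y) : Set (Measure (X × Y)) :=
  {π | IsProbabilityMeasure π ∧ π.map Prod.fst = P ∧ π.map Prod.snd = Q}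

/-- The total cost `∫ d^R_{μ,ν}(z, w) dπ(z, w)` of a measure `π` on the bidisk. -/
def totalCost (R : ℝ) (μ ν : 𝔻 → ℝ) (π : Measure (𝔻 × 𝔻)) : ℝ :=
  ∫ p, cost R μ ν p.1 p.2 ∂π

end ConformalWasserstein

end

open Set Topology Filter

noncomputable section

namespace ConformalWasserstein

/-! The cost is continuous with values in `[0, 2]`, so it is integrable against every coupling, and
the existence of a minimizer is the Kantorovich problem for a bounded continuous cost on a Polish
space.

Continuity is the geometric point. In coordinates centered at `z₀` and `w₀`, the admissible Möbius
maps are exactly the rotations (`mem_diskMobius_and_apply_eq_iff`). Since hyperbolic area is Möbius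
invariant (`measurePreserving_mobius`), the cost becomes an infimum over the compact circle of
integrals over one fixed compact disk, jointly continuous in all parameters. Invariance also yields
the bound 2.

A minimizer exists because the couplings form a weakly compact set (`isCompact_couplings`), on which
the total cost is weakly continuous. -/

instance instPolishSpaceUnitDisc : PolishSpace 𝔻 :=
  (Metric.isOpen_ball (x := (0 : ℂ)) (ε := 1)).polishSpace

theorem range_coe_unitDisc : range ((↑) : 𝔻 → ℂ) = Metric.ball 0 1 := Subtype.range_coe

theorem isOpenEmbedding_coe_unitDisc : IsOpenEmbedding ((↑) : 𝔻 → ℂ) :=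
  ⟨Complex.UnitDisc.isEmbedding_coe, range_coe_unitDisc ▸ Metric.isOpen_ball⟩

instance instLocallyCompactSpaceUnitDisc : LocallyCompactSpace 𝔻 :=
  isOpenEmbedding_coe_unitDisc.locallyCompactSpace

theorem measurableEmbedding_coe_unitDisc : MeasurableEmbedding ((↑) : 𝔻 → ℂ) :=
  isOpenEmbedding_coe_unitDisc.measurableEmbedding

/-! ### Algebra and topology of disk-preserving Möbius maps. -/

theorem coe_mobius (τ : Circle) (a z : 𝔻) :
    (mobius τ a z : ℂ) = τ * (((z : ℂ) - a) / (1 - conj (a : ℂ) * z)) := by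
  simp [mobius]

theorem circle_mul_conj (τ : Circle) : (τ : ℂ) * conj (τ : ℂ) = 1 := by
  rw [Complex.mul_conj]; simp

/-- The inverse of a disk-preserving Möbius transformation. -/
theorem mobius_inv_mobius (τ : Circle) (a z : 𝔻) :
    mobius τ⁻¹ (-(τ • a)) (mobius τ a z) = z := by
  have h1 := one_sub_conj_mul_ne_zero a z
  have h2 := one_sub_conj_mul_ne_zero (-(τ • a)) (mobius τ a z)
  have hτ := circle_mul_conj τ
  apply Complex.UnitDisc.coe_injective
  rw [coe_mobius, mul_div_assoc', div_eq_iff h2]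
  simp only [coe_mobius, Complex.UnitDisc.coe_neg, Complex.UnitDisc.coe_circle_smul, map_neg,
    map_mul, Circle.coe_inv_eq_conj]
  have hw := div_mul_cancel₀ ((z : ℂ) - a) h1
  generalize ((z : ℂ) - a) / (1 - conj (a : ℂ) * z) = w at hw ⊢
  linear_combination (w + a - z * conj (a : ℂ) * w) * hτ + hw

theorem mobius_mobius_inv (τ : Circle) (a z : 𝔻) :
    mobius τ a (mobius τ⁻¹ (-(τ • a)) z) = z := by
  have h : -(τ⁻¹ • -(τ • a)) = a := by
    apply Complex.UnitDisc.coe_injective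
    simp
  simpa [h] using mobius_inv_mobius τ⁻¹ (-(τ • a)) z

theorem mobius_self (τ : Circle) (a : 𝔻) : mobius τ a a = 0 := by
  apply Complex.UnitDisc.coe_injective
  simp [coe_mobius]

theorem mobius_zero (τ : Circle) (z : 𝔻) : mobius τ 0 z = τ • z := by
  apply Complex.UnitDisc.coe_injective
  simp [coe_mobius]

/-- The new center is the zero of the composite, i.e. the preimage of `a` under `mobius σ b`;
clearing denominators leaves the extra unimodular factor `d / conj d`. -/
theorem mobius_comp_mem_diskMobius (τ σ : Circle) (a b : 𝔻) :
    mobius τ a ∘ mobius σ b ∈ diskMobius := by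
  have hσi : ((σ : ℂ))⁻¹ = conj (σ : ℂ) := by
    rw [← Circle.coe_inv, Circle.coe_inv_eq_conj]
  set d : ℂ := 1 - conj (-(b : ℂ)) * (conj (σ : ℂ) * a) with hd
  have hd0 : d ≠ 0 := by
    have := one_sub_conj_mul_ne_zero (-b) (σ⁻¹ • a)
    simpa [hd, hσi] using this
  have hd1 : conj d ≠ 0 := by simpa using hd0
  refine ⟨τ * σ * (Circle.ofConjDivSelf (conj d) hd1), mobius 1 (-b) (σ⁻¹ • a), ?_⟩
  funext z
  have h1 := one_sub_conj_mul_ne_zero b z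
  have h2 := one_sub_conj_mul_ne_zero a (mobius σ b z)
  have h3 := one_sub_conj_mul_ne_zero (mobius 1 (-b) (σ⁻¹ • a)) z
  have hσ := circle_mul_conj σ
  apply Complex.UnitDisc.coe_injective
  rw [Function.comp_apply, coe_mobius τ, coe_mobius (τ * σ * _)]
  have e1 : (mobius 1 (-b) (σ⁻¹ • a) : ℂ) = (conj (σ : ℂ) * a + b) / d := by
    simp [coe_mobius, hd, hσi]
  have e2 : ((τ * σ * Circle.ofConjDivSelf (conj d) hd1 : Circle) : ℂ) = τ * σ * (d / conj d) := by
    rw [Circle.coe_mul, Circle.coe_mul]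
    congr 2
    simp [Circle.ofConjDivSelf]
  rw [e1] at h3 ⊢
  rw [e2]
  rw [coe_mobius σ] at h2 ⊢
  rw [map_div₀] at h3 ⊢
  obtain ⟨q, hq⟩ : ∃ q : ℂ, 1 - conj (b : ℂ) * z = q := ⟨_, rfl⟩
  rw [hq] at h1 h2 ⊢
  have k2 : q - conj (a : ℂ) * (σ * (z - b)) ≠ 0 := by
    intro h
    apply h2
    field_simp
    linear_combination h
  have k3 : conj d - conj (conj (σ : ℂ) * a + b) * z ≠ 0 := by
    intro h
    apply h3
    field_simp
    linear_combination h
  have l : (τ : ℂ) * (((σ : ℂ) * ((z - b) / q) - a) /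
      (1 - conj (a : ℂ) * (σ * ((z - b) / q)))) =
      τ * ((σ * (z - b) - a * q) /
        (q - conj (a : ℂ) * (σ * (z - b)))) := by
    field_simp
  have r : (τ : ℂ) * σ * (d / conj d) * ((z - (conj (σ : ℂ) * a + b) / d) /
      (1 - conj (conj (σ : ℂ) * a + b) / conj d * z)) =
      τ * (σ * (d * z - (conj (σ : ℂ) * a + b)) /
        (conj d - conj (conj (σ : ℂ) * a + b) * z)) := by
    field_simp
  rw [l, r]
  congr 1
  subst hq
  have n : σ * (d * z - (conj (σ : ℂ) * a + b)) = σ * (z - b) - a * (1 - conj (b : ℂ) * z) := by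
    simp only [hd, map_neg]
    linear_combination (a * conj (b : ℂ) * z - a) * hσ
  have m : conj d - conj (conj (σ : ℂ) * a + b) * z =
      1 - conj (b : ℂ) * z - conj (a : ℂ) * (σ * (z - b)) := by
    simp only [hd, map_sub, map_neg, map_mul, map_one, map_add, Complex.conj_conj]
    ring
  rw [n, m]

theorem continuous_mobius :
    Continuous fun p : Circle × 𝔻 × 𝔻 => mobius p.1 p.2.1 p.2.2 := by
  rw [Complex.UnitDisc.isEmbedding_coe.continuous_iff]
  simp only [Function.comp_def, coe_mobius]
  have c1 : Continuous fun p : Circle × 𝔻 × 𝔻 => (p.2.1 : ℂ) :=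
    Complex.UnitDisc.continuous_coe.comp (by fun_prop)
  have c2 : Continuous fun p : Circle × 𝔻 × 𝔻 => (p.2.2 : ℂ) :=
    Complex.UnitDisc.continuous_coe.comp (by fun_prop)
  exact (continuous_induced_dom.comp continuous_fst).mul
    ((c2.sub c1).div (continuous_const.sub ((Complex.continuous_conj.comp c1).mul c2))
      fun p => one_sub_conj_mul_ne_zero _ _)

theorem continuous_mobius_apply {X : Type*} [TopologicalSpace X] {τ : X → Circle} {a z : X → 𝔻}
    (hτ : Continuous τ) (ha : Continuous a) (hz : Continuous z) :
    Continuous fun x => mobius (τ x) (a x) (z x) :=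
  continuous_mobius.comp (hτ.prodMk (ha.prodMk hz))

/-- A disk-preserving Möbius transformation as a homeomorphism of the disk. -/
def mobiusHomeomorph (τ : Circle) (a : 𝔻) : 𝔻 ≃ₜ 𝔻 where
  toFun := mobius τ a
  invFun := mobius τ⁻¹ (-(τ • a))
  left_inv := mobius_inv_mobius τ a
  right_inv := mobius_mobius_inv τ a
  continuous_toFun := continuous_mobius_apply continuous_const continuous_const continuous_id
  continuous_invFun := continuous_mobius_apply continuous_const continuous_const continuous_id

/-- Every disk-preserving Möbius transformation taking `z₀` to `w₀` is a rotation in the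
coordinates centered at `z₀` and `w₀`. -/
theorem mem_diskMobius_and_apply_eq_iff {m : 𝔻 → 𝔻} {z₀ w₀ : 𝔻} :
    m ∈ diskMobius ∧ m z₀ = w₀ ↔
      ∃ σ : Circle, m = fun z => mobius 1 (-w₀) (σ • mobius 1 z₀ z) := by
  constructor
  · rintro ⟨⟨τ, a, rfl⟩, rfl⟩
    obtain ⟨σ, b, h⟩ := mobius_comp_mem_diskMobius τ 1 a (-z₀)
    obtain ⟨ρ, c, h'⟩ := mobius_comp_mem_diskMobius 1 σ (mobius τ a z₀) b
    have key (u : 𝔻) : mobius 1 (mobius τ a z₀) (mobius τ a (mobius 1 (-z₀) u)) =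
        mobius ρ c u := by
      rw [← congrFun h', ← h]; rfl
    have h0 : mobius 1 (-z₀) 0 = z₀ := by
      simpa [mobius_self] using mobius_inv_mobius 1 z₀ z₀
    -- The conjugated map sends both `0` and its center `c` to `0`, so injectivity forces `c = 0`,
    -- leaving a rotation.
    have hc : c = 0 := by
      have h1 := key 0
      rw [h0, mobius_self] at h1
      have h2 := mobius_inv_mobius ρ c 0
      rw [← h1] at h2
      have h3 := mobius_inv_mobius ρ c c
      rw [mobius_self] at h3
      exact h3.symm.trans h2
    subst hc
    refine ⟨ρ, funext fun z => ?_⟩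
    rw [← mobius_zero, ← key]
    have e1 := mobius_inv_mobius 1 z₀ z
    have e2 := mobius_inv_mobius 1 (mobius τ a z₀) (mobius τ a z)
    simp only [inv_one, one_smul] at e1 e2
    rw [e1, e2]
  · rintro ⟨σ, rfl⟩
    constructor
    · obtain ⟨τ, b, h⟩ := mobius_comp_mem_diskMobius 1 σ (-w₀) 0
      have h2 := mobius_comp_mem_diskMobius τ 1 b z₀
      rw [← h] at h2
      convert! h2 using 2 with z
      simp [mobius_zero]
    · have h := mobius_inv_mobius 1 w₀ w₀
      simp only [inv_one, one_smul, mobius_self] at h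
      simp only [mobius_self]
      convert h using 2
      apply Complex.UnitDisc.coe_injective
      simp

/-! ### Möbius invariance of hyperbolic area. -/

theorem hypVolume_eq_setLIntegral {s : Set 𝔻} (hs : MeasurableSet s) :
    hypVolume s =
      ∫⁻ z : ℂ in (↑) '' s, ENNReal.ofReal (((1 - ‖z‖ ^ 2) ^ 2)⁻¹) := by
  have : MeasurePreserving ((↑) : 𝔻 → ℂ) ((volume : Measure ℂ).comap ((↑) : 𝔻 → ℂ))
      (volume.restrict (range ((↑) : 𝔻 → ℂ))) :=
    ⟨measurableEmbedding_coe_unitDisc.measurable, by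
      rw [measurableEmbedding_coe_unitDisc.map_comap]⟩
  rw [hypVolume, withDensity_apply _ hs, ← inter_eq_self_of_subset_left (image_subset_range _ _),
    ← Measure.restrict_restrict' measurableEmbedding_coe_unitDisc.measurableSet_range,
    ← this.setLIntegral_comp_emb measurableEmbedding_coe_unitDisc]

/-- The factor multiplying `1 - ‖z‖ ^ 2` is the modulus of the derivative of `mobius τ a` at `z`, so
the density of `hypVolume` exactly absorbs the Jacobian. -/
theorem one_sub_norm_mobius_sq (τ : Circle) (a z : 𝔻) :
    1 - ‖(mobius τ a z : ℂ)‖ ^ 2 =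
      (1 - ‖(a : ℂ)‖ ^ 2) * (1 - ‖(z : ℂ)‖ ^ 2) / ‖1 - conj (a : ℂ) * z‖ ^ 2 := by
  have h := norm_ne_zero_iff.mpr (one_sub_conj_mul_ne_zero a z)
  rw [coe_mobius, norm_mul, Circle.norm_coe, one_mul, norm_div, div_pow,
    eq_div_iff (pow_ne_zero 2 h), sub_mul, div_mul_cancel₀ _ (pow_ne_zero 2 h)]
  simp only [← Complex.normSq_eq_norm_sq, Complex.normSq_apply, Complex.sub_re, Complex.sub_im,
    Complex.mul_re, Complex.mul_im, Complex.conj_re, Complex.conj_im, Complex.one_re,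
    Complex.one_im]
  ring

theorem hasDerivAt_mobius (τ : Circle) (a z : 𝔻) :
    HasDerivAt (fun x : ℂ => (τ : ℂ) * ((x - a) / (1 - conj (a : ℂ) * x)))
      (τ * ((1 - conj (a : ℂ) * a) / (1 - conj (a : ℂ) * z) ^ 2)) z := by
  have h1 : HasDerivAt (fun x : ℂ => x - a) 1 z := (hasDerivAt_id _).sub_const _
  have h2 : HasDerivAt (fun x : ℂ => 1 - conj (a : ℂ) * x) (-(conj (a : ℂ) * 1)) z :=
    ((hasDerivAt_id _).const_mul _).const_sub _
  convert! (h1.fun_div h2 (one_sub_conj_mul_ne_zero a z)).const_mul (τ : ℂ) using 3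
  ring

theorem measurableEmbedding_mobius (τ : Circle) (a : 𝔻) : MeasurableEmbedding (mobius τ a) :=
  (mobiusHomeomorph τ a).measurableEmbedding

theorem hypVolume_image_mobius (τ : Circle) (a : 𝔻) {s : Set 𝔻} (hs : MeasurableSet s) :
    hypVolume (mobius τ a '' s) = hypVolume s := by
  rw [hypVolume_eq_setLIntegral ((measurableEmbedding_mobius τ a).measurableSet_image.mpr hs),
    hypVolume_eq_setLIntegral hs]
  set f : ℂ → ℂ := fun x => (τ : ℂ) * ((x - a) / (1 - conj (a : ℂ) * x)) with hf
  have himg : ((↑) : 𝔻 → ℂ) '' (mobius τ a '' s) = f '' ((↑) '' s) := by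
    rw [image_image, image_image]
    exact image_congr fun z _ => coe_mobius τ a z
  have hinj : InjOn f ((↑) '' s) := by
    rintro _ ⟨x, -, rfl⟩ _ ⟨y, -, rfl⟩ hxy
    have : mobius τ a x = mobius τ a y := by
      apply Complex.UnitDisc.coe_injective
      rw [coe_mobius, coe_mobius]
      exact hxy
    rw [(mobiusHomeomorph τ a).injective this]
  have hs' := measurableEmbedding_coe_unitDisc.measurableSet_image.mpr hs
  set f' : ℂ → ℂ := fun z => τ * ((1 - conj (a : ℂ) * a) / (1 - conj (a : ℂ) * z) ^ 2) with hf'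
  have hd : ∀ x ∈ ((↑) : 𝔻 → ℂ) '' s, HasFDerivWithinAt f
      ((ContinuousLinearMap.toSpanSingleton ℂ (f' x)).restrictScalars ℝ) ((↑) '' s) x := by
    rintro _ ⟨z, -, rfl⟩
    exact ((hasDerivAt_mobius τ a z).hasFDerivAt.restrictScalars ℝ).hasFDerivWithinAt
  rw [himg, lintegral_image_eq_lintegral_abs_det_fderiv_mul volume hs' hd hinj]
  refine setLIntegral_congr_fun hs' ?_
  rintro _ ⟨z, -, rfl⟩
  -- The real Jacobian of a holomorphic map is the squared modulus of its derivative.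
  have hdet : ((ContinuousLinearMap.toSpanSingleton ℂ (f' z)).restrictScalars ℝ).det =
      ‖f' z‖ ^ 2 := by
    simp [ContinuousLinearMap.det, LinearMap.det_restrictScalars,
      Algebra.norm_complex_eq, Complex.normSq_eq_norm_sq]
  have hfz : f z = mobius τ a z := (coe_mobius τ a z).symm
  have hz := sub_pos.mpr z.sq_norm_lt_one
  have ha := sub_pos.mpr a.sq_norm_lt_one
  have hn : ‖1 - conj (a : ℂ) * a‖ = 1 - ‖(a : ℂ)‖ ^ 2 := by
    rw [Complex.conj_mul', ← Complex.ofReal_pow, ← Complex.ofReal_one, ← Complex.ofReal_sub,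
      Complex.norm_real, Real.norm_of_nonneg ha.le]
  have h0 := norm_ne_zero_iff.mpr (one_sub_conj_mul_ne_zero a z)
  simp only
  rw [hdet, hfz, one_sub_norm_mobius_sq, ← ENNReal.ofReal_mul (abs_nonneg _),
    abs_of_nonneg (by positivity)]
  congr 1
  rw [hf', norm_mul, Circle.norm_coe, one_mul, norm_div, norm_pow, hn]
  field_simp

/-- The hyperbolic area is invariant under disk-preserving Möbius transformations. -/
theorem measurePreserving_mobius (τ : Circle) (a : 𝔻) :
    MeasurePreserving (mobius τ a) hypVolume hypVolume := by
  refine ⟨(measurableEmbedding_mobius τ a).measurable, Measure.ext fun s hs => ?_⟩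
  have hm := (measurableEmbedding_mobius τ a).measurable
  rw [Measure.map_apply hm hs,
    ← hypVolume_image_mobius τ a (hm hs)]
  congr 1
  exact image_preimage_eq s (mobiusHomeomorph τ a).surjective

instance instIsLocallyFiniteMeasureHypVolume : IsLocallyFiniteMeasure hypVolume := by
  have : IsLocallyFiniteMeasure ((volume : Measure ℂ).comap ((↑) : 𝔻 → ℂ)) := by
    refine ⟨fun z => ?_⟩
    obtain ⟨s, hs, hs'⟩ := (volume : Measure ℂ).finiteAt_nhds (z : ℂ)
    refine ⟨(↑) ⁻¹' s, Complex.UnitDisc.continuous_coe.continuousAt.preimage_mem_nhds hs, ?_⟩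
    rw [measurableEmbedding_coe_unitDisc.comap_apply]
    exact (measure_mono (image_preimage_subset _ _)).trans_lt hs'
  refine IsLocallyFiniteMeasure.withDensity_ofReal (Continuous.inv₀ ?_ fun z => ?_)
  · exact (continuous_const.sub (Complex.UnitDisc.continuous_coe.norm.pow 2)).pow 2
  · exact pow_ne_zero 2 (sub_pos.mpr z.sq_norm_lt_one).ne'

/-! ### Continuity and bounds for the cost. -/

theorem mobius_one_zero (z : 𝔻) : mobius 1 0 z = z := by
  rw [mobius_zero, one_smul]

theorem mem_hypDisk_zero {R : ℝ} {z : 𝔻} : z ∈ hypDisk R 0 ↔ ‖(z : ℂ)‖ ≤ Real.tanh R := by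
  rw [hypDisk, mem_ofPred_eq, mobius_one_zero]

theorem isCompact_hypDisk_zero (R : ℝ) : IsCompact (hypDisk R 0) := by
  rw [Complex.UnitDisc.isEmbedding_coe.isCompact_iff]
  convert! isCompact_closedBall (0 : ℂ) (Real.tanh R) using 1
  ext z
  simp only [mem_image, mem_hypDisk_zero, mem_closedBall_zero_iff]
  constructor
  · rintro ⟨w, hw, rfl⟩
    exact hw
  · exact fun hz => ⟨.mk z (hz.trans_lt (Real.tanh_lt_one R)), hz, rfl⟩

/-- The mismatch of `μ` and `ν` on disks of radius `R` around `z` and `w`, after moving both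
centers to the origin and rotating by `σ`. -/
def centeredMismatch (R : ℝ) (μ ν : 𝔻 → ℝ) (z w : 𝔻) (σ : Circle) : ℝ :=
  ∫ u in hypDisk R 0, |μ (mobius 1 (-z) u) - ν (mobius 1 (-w) (σ • u))| ∂hypVolume

/-- Area-preserving substitution `u = mobius 1 z x`. Afterwards neither the domain of integration
nor the range of `σ` depends on the base points. -/
theorem patchMismatch_eq_centeredMismatch (R : ℝ) (μ ν : 𝔻 → ℝ) (z w : 𝔻) (σ : Circle) :
    patchMismatch R μ ν z (fun x => mobius 1 (-w) (σ • mobius 1 z x)) =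
      centeredMismatch R μ ν z w σ := by
  have hpre : hypDisk R z = mobius 1 z ⁻¹' hypDisk R 0 := by
    ext x
    rw [mem_preimage, mem_hypDisk_zero]
    rfl
  rw [patchMismatch, centeredMismatch, hpre]
  refine Eq.trans ?_ ((measurePreserving_mobius 1 z).setIntegral_preimage_emb
    (measurableEmbedding_mobius 1 z) _ _)
  congr 1
  funext x
  have h := mobius_inv_mobius 1 z x
  simp only [inv_one, one_smul] at h
  simp only [h]

theorem cost_eq_sInf (R : ℝ) (μ ν : 𝔻 → ℝ) (z w : 𝔻) :
    cost R μ ν z w = sInf (centeredMismatch R μ ν z w '' univ) := by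
  rw [cost, iInf, image_univ]
  congr 1
  ext t
  constructor
  · rintro ⟨⟨m, hm⟩, rfl⟩
    obtain ⟨σ, rfl⟩ := mem_diskMobius_and_apply_eq_iff.mp hm
    exact ⟨σ, (patchMismatch_eq_centeredMismatch R μ ν z w σ).symm⟩
  · rintro ⟨σ, rfl⟩
    exact ⟨⟨_, mem_diskMobius_and_apply_eq_iff.mpr ⟨σ, rfl⟩⟩,
      patchMismatch_eq_centeredMismatch R μ ν z w σ⟩

theorem continuous_centeredMismatch_integrand {μ ν : 𝔻 → ℝ} (hμ : Continuous μ)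
    (hν : Continuous ν) :
    Continuous fun p : ((𝔻 × 𝔻) × Circle) × 𝔻 =>
      |μ (mobius 1 (-p.1.1.1) p.2) - ν (mobius 1 (-p.1.1.2) (p.1.2 • p.2))| := by
  have hneg : Continuous fun z : 𝔻 => -z := by
    rw [Complex.UnitDisc.isEmbedding_coe.continuous_iff]
    exact Complex.UnitDisc.continuous_coe.neg
  have hsmul : Continuous fun p : Circle × 𝔻 => p.1 • p.2 := by
    simp_rw [← mobius_zero]
    exact continuous_mobius_apply continuous_fst continuous_const continuous_snd
  refine ((hμ.comp (continuous_mobius_apply continuous_const ?_ continuous_snd)).sub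
    (hν.comp (continuous_mobius_apply continuous_const ?_ ?_))).abs
  · exact hneg.comp (by fun_prop)
  · exact hneg.comp (by fun_prop)
  · exact hsmul.comp (f := fun p : ((𝔻 × 𝔻) × Circle) × 𝔻 => (p.1.2, p.2)) (by fun_prop)

theorem continuous_centeredMismatch (R : ℝ) {μ ν : 𝔻 → ℝ} (hμ : Continuous μ)
    (hν : Continuous ν) :
    Continuous fun p : (𝔻 × 𝔻) × Circle => centeredMismatch R μ ν p.1.1 p.1.2 p.2 :=
  continuous_parametric_integral_of_continuous
    (f := fun (p : (𝔻 × 𝔻) × Circle) u =>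
      |μ (mobius 1 (-p.1.1) u) - ν (mobius 1 (-p.1.2) (p.2 • u))|)
    (continuous_centeredMismatch_integrand hμ hν) (isCompact_hypDisk_zero R)

/-- An infimum of a jointly continuous function over a compact parameter space, here the circle, is
continuous. -/
theorem continuous_cost (R : ℝ) {μ ν : 𝔻 → ℝ} (hμ : Continuous μ) (hν : Continuous ν) :
    Continuous fun p : 𝔻 × 𝔻 => cost R μ ν p.1 p.2 := by
  simp_rw [cost_eq_sInf]
  exact isCompact_univ.continuous_sInf (f := fun (p : 𝔻 × 𝔻) => centeredMismatch R μ ν p.1 p.2)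
    (continuous_centeredMismatch R hμ hν)

theorem centeredMismatch_nonneg (R : ℝ) (μ ν : 𝔻 → ℝ) (z w : 𝔻) (σ : Circle) :
    0 ≤ centeredMismatch R μ ν z w σ :=
  integral_nonneg fun _ => abs_nonneg _

theorem cost_nonneg (R : ℝ) (μ ν : 𝔻 → ℝ) (z w : 𝔻) : 0 ≤ cost R μ ν z w :=
  Real.iInf_nonneg fun _ => integral_nonneg fun _ => abs_nonneg _

theorem IsHyperbolicDensity.integrable {μ : 𝔻 → ℝ} (hμ : IsHyperbolicDensity μ) :
    Integrable μ hypVolume :=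
  ⟨hμ.continuous.aestronglyMeasurable, by
    rw [hasFiniteIntegral_iff_ofReal (.of_forall fun z => (hμ.pos z).le), hμ.lintegral_eq_one]
    exact ENNReal.one_lt_top⟩

theorem IsHyperbolicDensity.integral_eq_one {μ : 𝔻 → ℝ} (hμ : IsHyperbolicDensity μ) :
    ∫ z, μ z ∂hypVolume = 1 := by
  rw [integral_eq_lintegral_of_nonneg_ae (.of_forall fun z => (hμ.pos z).le)
    hμ.continuous.aestronglyMeasurable, hμ.lintegral_eq_one, ENNReal.toReal_one]

theorem IsHyperbolicDensity.comp {μ : 𝔻 → ℝ} (hμ : IsHyperbolicDensity μ) {φ : 𝔻 → 𝔻}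
    (hφ : φ ∈ diskMobius) : IsHyperbolicDensity (μ ∘ φ) := by
  obtain ⟨τ, a, rfl⟩ := hφ
  refine ⟨hμ.continuous.comp (mobiusHomeomorph τ a).continuous, fun z => hμ.pos _, ?_⟩
  rw [← hμ.lintegral_eq_one]
  exact (measurePreserving_mobius τ a).lintegral_comp_emb (measurableEmbedding_mobius τ a)
    fun z => ENNReal.ofReal (μ z)

/-- The single rotation `σ = 1` suffices: its mismatch is at most the sum of the total masses of the
two transported densities, each still 1 by invariance. -/
theorem cost_le_two (R : ℝ) {μ ν : 𝔻 → ℝ} (hμ : IsHyperbolicDensity μ)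
    (hν : IsHyperbolicDensity ν) (z w : 𝔻) : cost R μ ν z w ≤ 2 := by
  have hbdd : BddBelow (centeredMismatch R μ ν z w '' univ) :=
    ⟨0, by rintro _ ⟨σ, -, rfl⟩; exact centeredMismatch_nonneg R μ ν z w σ⟩
  rw [cost_eq_sInf]
  refine (csInf_le hbdd ⟨1, mem_univ _, rfl⟩).trans ?_
  have h1 := hμ.comp (φ := mobius 1 (-z)) ⟨1, -z, rfl⟩
  have h2 := hν.comp (φ := mobius 1 (-w)) ⟨1, -w, rfl⟩
  simp only [centeredMismatch, one_smul]
  calc ∫ u in hypDisk R 0, |μ (mobius 1 (-z) u) - ν (mobius 1 (-w) u)| ∂hypVolume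
      ≤ ∫ u, |μ (mobius 1 (-z) u) - ν (mobius 1 (-w) u)| ∂hypVolume :=
        setIntegral_le_integral (h1.integrable.sub h2.integrable).abs
          (.of_forall fun _ => abs_nonneg _)
    _ ≤ ∫ u, ((μ ∘ mobius 1 (-z)) u + (ν ∘ mobius 1 (-w)) u) ∂hypVolume := by
        refine integral_mono (h1.integrable.sub h2.integrable).abs
          (h1.integrable.add h2.integrable) fun u => ?_
        refine (abs_sub _ _).trans_eq ?_
        exact congrArg₂ _ (abs_of_pos (h1.pos u)) (abs_of_pos (h2.pos u))
    _ = 2 := by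
        rw [integral_add h1.integrable h2.integrable, h1.integral_eq_one, h2.integral_eq_one]
        norm_num

/-! ### Compactness of couplings and the Kantorovich problem. -/

theorem IsHyperbolicDensity.isProbabilityMeasure {μ : 𝔻 → ℝ} (hμ : IsHyperbolicDensity μ) :
    IsProbabilityMeasure (densityMeasure μ) :=
  ⟨by rw [densityMeasure, withDensity_apply _ .univ, Measure.restrict_univ,
    hμ.lintegral_eq_one]⟩

/-- The set of couplings of two Borel probability measures on Polish spaces is compact for the
topology of convergence in distribution. -/
theorem isCompact_couplings {X Y : Type*} [TopologicalSpace X] [PolishSpace X]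
    [MeasurableSpace X] [BorelSpace X] [TopologicalSpace Y] [PolishSpace Y]
    [MeasurableSpace Y] [BorelSpace Y] (P : ProbabilityMeasure X) (Q : ProbabilityMeasure Y) :
    IsCompact {π : ProbabilityMeasure (X × Y) | (π : Measure (X × Y)) ∈
      couplings (P : Measure X) (Q : Measure Y)} := by
  set S := {π : ProbabilityMeasure (X × Y) | (π : Measure (X × Y)) ∈
      couplings (P : Measure X) (Q : Measure Y)} with hS
  have hclosed : IsClosed S := by
    have : S = {π | π.map measurable_fst.aemeasurable = P} ∩
        {π | π.map measurable_snd.aemeasurable = Q} := by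
      ext π
      exact ⟨fun h => ⟨Subtype.ext h.2.1, Subtype.ext h.2.2⟩,
        fun h => ⟨π.2, congrArg Subtype.val h.1, congrArg Subtype.val h.2⟩⟩
    rw [this]
    let := TopologicalSpace.upgradeIsCompletelyMetrizable X
    let := TopologicalSpace.upgradeIsCompletelyMetrizable Y
    exact (isClosed_singleton.preimage (ProbabilityMeasure.continuous_map continuous_fst)).inter
      (isClosed_singleton.preimage (ProbabilityMeasure.continuous_map continuous_snd))
  -- Each marginal is a single probability measure on a Polish space, hence tight, and tight
  -- marginals make the joint laws tight.
  have htight : IsTightMeasureSet {((π : ProbabilityMeasure (X × Y)) : Measure (X × Y)) |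
      π ∈ S} := by
    refine IsTightMeasureSet.prodMk ?_ ?_
    · refine (isTightMeasureSet_singleton (μ := (P : Measure X))).subset ?_
      rintro _ ⟨_, ⟨π, hπ, rfl⟩, rfl⟩
      exact hπ.2.1
    · refine (isTightMeasureSet_singleton (μ := (Q : Measure Y))).subset ?_
      rintro _ ⟨_, ⟨π, hπ, rfl⟩, rfl⟩
      exact hπ.2.2
  -- Prokhorov's theorem: a tight family has compact closure.
  simpa [hclosed.closure_eq] using isCompact_closure_of_isTightMeasureSet htight

/-- **Kantorovich problem**: for a bounded continuous cost, an optimal coupling exists. -/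
theorem exists_optimal_coupling {X Y : Type*} [TopologicalSpace X] [PolishSpace X]
    [MeasurableSpace X] [BorelSpace X] [TopologicalSpace Y] [PolishSpace Y]
    [MeasurableSpace Y] [BorelSpace Y] (P : Measure X) [IsProbabilityMeasure P]
    (Q : Measure Y) [IsProbabilityMeasure Q] (c : BoundedContinuousFunction (X × Y) ℝ) :
    ∃ π' ∈ couplings P Q, ∫ p, c p ∂π' = ⨅ π : couplings P Q, ∫ p, c p ∂π.1 := by
  have hne : P.prod Q ∈ couplings P Q :=
    ⟨inferInstance, by simp, by simp⟩
  obtain ⟨π', hπ', hmin⟩ := (isCompact_couplings ⟨P, inferInstance⟩ ⟨Q, inferInstance⟩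
    ).exists_isMinOn ⟨⟨P.prod Q, inferInstance⟩, hne⟩
    (ProbabilityMeasure.continuous_integral_boundedContinuousFunction c).continuousOn
  have hle (π : couplings P Q) : ∫ p, c p ∂(π' : Measure (X × Y)) ≤ ∫ p, c p ∂π.1 :=
    hmin (a := ⟨π.1, π.2.1⟩) π.2
  have : Nonempty (couplings P Q) := ⟨⟨_, hne⟩⟩
  -- The minimal value itself serves as the lower bound that the real infimum requires.
  exact ⟨π', hπ', le_antisymm (le_ciInf hle)
    (ciInf_le ⟨_, forall_mem_range.mpr hle⟩ (⟨π', hπ'⟩ : couplings P Q))⟩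

end ConformalWasserstein

end

theorem mainTheorem4 (R : ℝ) (hR : 0 < R) (μ ν : Complex.UnitDisc → ℝ)
    (hμ : ConformalWasserstein.IsHyperbolicDensity μ)
    (hν : ConformalWasserstein.IsHyperbolicDensity ν) :
    (∀ π ∈ ConformalWasserstein.couplings (ConformalWasserstein.densityMeasure μ)
        (ConformalWasserstein.densityMeasure ν),
      Integrable (fun p : Complex.UnitDisc × Complex.UnitDisc =>
        ConformalWasserstein.cost R μ ν p.1 p.2) π) ∧
    ∃ π' ∈ ConformalWasserstein.couplings (ConformalWasserstein.densityMeasure μ)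
        (ConformalWasserstein.densityMeasure ν),
      ConformalWasserstein.totalCost R μ ν π' =
        ⨅ π : ConformalWasserstein.couplings (ConformalWasserstein.densityMeasure μ)
            (ConformalWasserstein.densityMeasure ν),
          ConformalWasserstein.totalCost R μ ν π.1 := by
  have hcont := ConformalWasserstein.continuous_cost R hμ.continuous hν.continuous
  have hbound (p : 𝔻 × 𝔻) : ‖ConformalWasserstein.cost R μ ν p.1 p.2‖ ≤ 2 := by
    rw [Real.norm_of_nonneg (ConformalWasserstein.cost_nonneg R μ ν p.1 p.2)]
    exact ConformalWasserstein.cost_le_two R hμ hν p.1 p.2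
  have := hμ.isProbabilityMeasure
  have := hν.isProbabilityMeasure
  refine ⟨fun π hπ => ?_, ?_⟩
  · have := hπ.1
    exact .of_bound hcont.aestronglyMeasurable 2 (.of_forall hbound)
  · exact ConformalWasserstein.exists_optimal_coupling (ConformalWasserstein.densityMeasure μ)
      (ConformalWasserstein.densityMeasure ν) (.ofNormedAddCommGroup _ hcont 2 hbound)
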